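/- Let $n\ge 1$ and let $K\subset\mathbb{R}^n$ be a compact $n$-dimensional smooth ($C^\infty$) submanifold with boundary $\Sigma=\partial K$. Let $d\Sigma$ be the $(n-1)$-dimensional area measure of $\Sigma$ (counting measure if $n=1$), $\mathcal V_{n-1}(\Sigma)=\int_\Sigma d\Sigma$ its surface area, and $\tilde n(q)$ the outward unit normal of $K$ at $q\in\Sigma$. For a unit vector $\nu\in\mathbb{S}^{n-1}$ let $$\mathcal V_{n-1}(\Sigma\,|\,\nu^\perp)=\frac12\int_{q\in\Sigma}|\nu\cdot\tilde n(q)|\,d\Sigma_q$$ be the weighted projected area of $\Sigma$ along $\nu$. Let $\omega_{n-1}$ be the volume of the unit ball in $\mathbb{R}^{n-1}$, $dS$ the surface measure of $\mathbb{S}^{n-1}$ and $\mu_n$ the Lebesgue measure on $\mathbb{R}^n$. For $\epsilon>0$ let $\mathrm{Tub}_\epsilon\Sigma=\{p+a : p\in\Sigma,\ a\in N_p\Sigma,\ |a|<\epsilon\}$, where $N_p\Sigma$ is the orthogonal complement of the tangent space $T_p\Sigma$. Then the limit below exists, all three quantities are finite, and $$\mathcal V_{n-1}(\Sigma)=\frac{1}{\omega_{n-1}}\int_{\nu\in\mathbb{S}^{n-1}}\mathcal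 V_{n-1}(\Sigma\,|\,\nu^\perp)\,dS_\nu=\lim_{\epsilon\downarrow 0}\frac{\mu_n(\mathrm{Tub}_\epsilon\Sigma)}{2\epsilon}.$$ -/

import Mathlib

open MeasureTheory Set Filter Topology
open scoped ContDiff ENNReal

noncomputable section

namespace CauchySurface

/-- A set `K ⊆ ℝⁿ` with smooth boundary: near every point of its topological boundary, `K` is the
sublevel set `{φ ≤ 0}` of a smooth function `φ` without critical points. A compact such `K` is
exactly a compact `n`-dimensional smooth embedded submanifold with boundary of `ℝⁿ`,
and its manifold boundary is `frontier K`. -/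
def HasSmoothBoundary {n : ℕ} (K : Set (EuclideanSpace ℝ (Fin n))) : Prop :=
  ∀ p ∈ frontier K, ∃ (U : Set (EuclideanSpace ℝ (Fin n))) (φ : EuclideanSpace ℝ (Fin n) → ℝ),
    IsOpen U ∧ p ∈ U ∧ ContDiffOn ℝ ∞ φ U ∧ (∀ x ∈ U, fderiv ℝ φ x ≠ 0) ∧
      ∀ x ∈ U, x ∈ K ↔ φ x ≤ 0

/-- The tangent space `T_p M` of `M ⊆ ℝⁿ` at `p`: the linear span of the velocities at `p` of the
curves that run in `M`. -/
def tangentSpaceAt {n : ℕ} (M : Set (EuclideanSpace ℝ (Fin n)))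
    (p : EuclideanSpace ℝ (Fin n)) : Submodule ℝ (EuclideanSpace ℝ (Fin n)) :=
  Submodule.span ℝ {v | ∃ γ : ℝ → EuclideanSpace ℝ (Fin n),
    γ 0 = p ∧ (∀ᶠ t in 𝓝 0, γ t ∈ M) ∧ HasDerivAt γ v 0}

/-- The normal space `N_p M`, the orthogonal complement of `T_p M` in `ℝⁿ`. -/
def normalSpaceAt {n : ℕ} (M : Set (EuclideanSpace ℝ (Fin n)))
    (p : EuclideanSpace ℝ (Fin n)) : Submodule ℝ (EuclideanSpace ℝ (Fin n)) :=
  (tangentSpaceAt M p)ᗮ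

/-- The normal tube `Tub_ε M = {p + a | p ∈ M, a ∈ N_p M, |a| < ε}`. -/
def tube {n : ℕ} (M : Set (EuclideanSpace ℝ (Fin n))) (ε : ℝ) :
    Set (EuclideanSpace ℝ (Fin n)) :=
  {x | ∃ p ∈ M, ∃ a ∈ normalSpaceAt M p, ‖a‖ < ε ∧ x = p + a}

/-- `u` is an outward unit normal of `K` at the boundary point `q`. -/
def IsOutwardUnitNormal {n : ℕ} (K : Set (EuclideanSpace ℝ (Fin n)))
    (q u : EuclideanSpace ℝ (Fin n)) : Prop :=
  ‖u‖ = 1 ∧ u ∈ normalSpaceAt (frontier K) q ∧ ∀ᶠ t : ℝ in 𝓝[>] 0, q + t • u ∉ K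

open Classical in
/-- The outward unit normal `ñ(q)` of `K` at `q ∈ ∂K`. When `K` has smooth boundary and `q ∈ ∂K`,
there is exactly one outward unit normal, and this is it; the value `0` is never used there. -/
def outwardNormal {n : ℕ} (K : Set (EuclideanSpace ℝ (Fin n)))
    (q : EuclideanSpace ℝ (Fin n)) : EuclideanSpace ℝ (Fin n) :=
  if h : ∃ u, IsOutwardUnitNormal K q u then h.choose else 0

/-- The area measure `dΣ` of `Σ = ∂K`: the `(n-1)`-dimensional Hausdorff measure, normalised to
agree with Lebesgue measure on `ℝⁿ⁻¹`, restricted to `∂K`. -/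
def boundaryMeasure {n : ℕ} (K : Set (EuclideanSpace ℝ (Fin n))) :
    Measure (EuclideanSpace ℝ (Fin n)) :=
  (Measure.euclideanHausdorffMeasure (n - 1)).restrict (frontier K)

/-- The surface area `𝒱_{n-1}(Σ)` of `Σ = ∂K`. -/
def surfaceArea {n : ℕ} (K : Set (EuclideanSpace ℝ (Fin n))) : ℝ≥0∞ :=
  ∫⁻ _q, 1 ∂(boundaryMeasure K)

/-- The weighted projected area of `Σ = ∂K` along the direction `ν`,
`𝒱_{n-1}(Σ | ν^⊥) = (1/2) ∫_{q ∈ Σ} |ν · ñ(q)| dΣ_q`. -/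
def weightedProjectedArea {n : ℕ} (K : Set (EuclideanSpace ℝ (Fin n)))
    (ν : EuclideanSpace ℝ (Fin n)) : ℝ≥0∞ :=
  (1 / 2) * ∫⁻ q, ENNReal.ofReal |inner ℝ ν (outwardNormal K q)| ∂(boundaryMeasure K)

/-- The volume `ω_m` of the unit ball of `ℝᵐ`. -/
def unitBallVolume (m : ℕ) : ℝ≥0∞ :=
  volume (Metric.ball (0 : EuclideanSpace ℝ (Fin m)) 1)

/-- The right-hand side of Cauchy's formula,
`(1/ω_{n-1}) ∫_{ν ∈ S^{n-1}} 𝒱_{n-1}(Σ | ν^⊥) dS_ν`. Here `volume.toSphere` is the surface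
measure of the unit sphere (the counting measure on the two points of `S⁰` when `n = 1`). -/
def cauchyArea {n : ℕ} (K : Set (EuclideanSpace ℝ (Fin n))) : ℝ≥0∞ :=
  (1 / unitBallVolume (n - 1)) *
    ∫⁻ ν : Metric.sphere (0 : EuclideanSpace ℝ (Fin n)) 1,
      weightedProjectedArea K ν
        ∂((volume : Measure (EuclideanSpace ℝ (Fin n))).toSphere)

end CauchySurface

end

namespace CauchySurface

/-! The two equalities have independent reasons, joined by finiteness of the area.

Cauchy's formula: by Tonelli the integral over `ν` is taken first, with `q` fixed. The mean of `|ν ·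
u|` over the sphere does not depend on the unit vector `u`, and `lintegral_sphere_abs_inner` finds
the integral to be `2 ω_{n-1}`. This cancels `1 / ω_{n-1}` and the weight `1 / 2`.

Tube formula: near a point of `Σ`, the hypersurface is almost its tangent hyperplane and the normal
is almost constant. So `(q, t) ↦ q + t ñ(q)` is compared with the flat map that first projects `q`
to the hyperplane. By `norm_normalExp_sub_flatExp_le` the two images are bi-Lipschitz equivalent
with constant near 1, hence have nearly equal volume; the projection likewise almost preserves area;
and a flat slab has volume exactly `2 ε` times its base. No Jacobian is needed. Compactness makes
this global (`exists_injOn_tubeBounds`): for every `M > 1` and small `ε`, the tube volume and `2 ε`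
times the area agree up to the factor `M`. Then `M → 1`.

The smooth boundary enters the tube estimates only through `IsUnitNormalField`. -/

/-! ### Hausdorff measure under Lipschitz comparison, and flat slabs. -/

/-- On `s`, `f` factors through `g` by a `C`-Lipschitz map. Parametrising both sets by `s` allows
comparison in either direction without naming the inverse maps. -/
theorem euclideanHausdorffMeasure_image_le_of_dist_le {α X Y : Type*} [Nonempty α]
    [MetricSpace X] [MeasurableSpace X] [BorelSpace X]
    [MetricSpace Y] [MeasurableSpace Y] [BorelSpace Y]
    {f : α → X} {g : α → Y} {s : Set α} {C : NNReal} (d : ℕ)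
    (h : ∀ a ∈ s, ∀ b ∈ s, dist (f a) (f b) ≤ C * dist (g a) (g b)) :
    (Measure.euclideanHausdorffMeasure d : Measure X) (f '' s) ≤
      (C : ℝ≥0∞) ^ d * (Measure.euclideanHausdorffMeasure d : Measure Y) (g '' s) := by
  classical
  set k : Y → X := fun y => f (Function.invFunOn g s y) with hk
  have hinv : ∀ a ∈ s, Function.invFunOn g s (g a) ∈ s ∧ g (Function.invFunOn g s (g a)) = g a :=
    fun a ha => ⟨Function.invFunOn_mem ⟨a, ha, rfl⟩, Function.invFunOn_eq ⟨a, ha, rfl⟩⟩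
  have hkf : ∀ a ∈ s, k (g a) = f a := by
    intro a ha
    have := h _ (hinv a ha).1 a ha
    rw [(hinv a ha).2, dist_self, mul_zero] at this
    exact dist_le_zero.1 this
  have himg : f '' s = k '' (g '' s) := by
    rw [image_image]
    exact image_congr fun a ha => (hkf a ha).symm
  have hlip : LipschitzOnWith C k (g '' s) := by
    refine LipschitzOnWith.of_dist_le_mul ?_
    rintro _ ⟨a, ha, rfl⟩ _ ⟨b, hb, rfl⟩
    rw [hkf a ha, hkf b hb]
    exact h a ha b hb
  have := hlip.hausdorffMeasure_image_le (d := d) (Nat.cast_nonneg d)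
  rw [himg, Measure.euclideanHausdorffMeasure_def, Measure.euclideanHausdorffMeasure_def,
    Measure.smul_apply, Measure.smul_apply, ENNReal.smul_def, ENNReal.smul_def, smul_eq_mul,
    smul_eq_mul, mul_left_comm]
  rw [ENNReal.rpow_natCast] at this
  gcongr

/-- The volume of a slab `B + (-ε, ε) ν` over a Borel subset `B` of the hyperplane `ν^⊥`. -/
theorem volume_slab {n : ℕ} {ν : EuclideanSpace ℝ (Fin n)} (hν : ‖ν‖ = 1)
    {B : Set (EuclideanSpace ℝ (Fin n))} (hB : MeasurableSet B)
    (hBν : ∀ x ∈ B, inner ℝ ν x = 0) (ε : ℝ) :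
    volume {x : EuclideanSpace ℝ (Fin n) | x - (inner ℝ ν x : ℝ) • ν ∈ B ∧
        (inner ℝ ν x : ℝ) ∈ Ioo (-ε) ε} =
      ENNReal.ofReal (2 * ε) * (Measure.euclideanHausdorffMeasure (n - 1)) B := by
  have hν0 : ν ≠ 0 := by
    rintro rfl
    simp at hν
  have hνν : (inner ℝ ν ν : ℝ) = 1 := by
    rw [real_inner_self_eq_norm_sq, hν]
    norm_num
  set T := {x : EuclideanSpace ℝ (Fin n) | x - (inner ℝ ν x : ℝ) • ν ∈ B ∧
        (inner ℝ ν x : ℝ) ∈ Ioo (-ε) ε} with hT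
  have hTm : MeasurableSet T := by
    refine MeasurableSet.inter ?_ ?_
    · exact hB.preimage (by fun_prop : Continuous fun x : EuclideanSpace ℝ (Fin n) =>
        x - (inner ℝ ν x : ℝ) • ν).measurable
    · exact measurableSet_Ioo.preimage (by fun_prop : Continuous fun x :
        EuclideanSpace ℝ (Fin n) => (inner ℝ ν x : ℝ)).measurable
  -- Fubini along `ν`: each slice orthogonal to `ν` is a translate of `B` or empty.
  have key := EuclideanGeometry.euclideanHausdorffMeasure_eq_lintegral
    (0 : EuclideanSpace ℝ (Fin n)) hν0 hTm
  rw [finrank_euclideanSpace_fin, EuclideanSpace.euclideanHausdorffMeasure_eq_volume] at key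
  have hslice : ∀ x : ℝ, T ∩ (AffineSubspace.mk' (x • ν +ᵥ (0 : EuclideanSpace ℝ (Fin n)))
      (Submodule.span ℝ {ν})ᗮ : Set (EuclideanSpace ℝ (Fin n))) =
      if x ∈ Ioo (-ε) ε then (fun y => x • ν + y) '' B else ∅ := by
    intro x
    ext y
    have hmem : y ∈ (AffineSubspace.mk' (x • ν +ᵥ (0 : EuclideanSpace ℝ (Fin n)))
      (Submodule.span ℝ {ν})ᗮ : Set (EuclideanSpace ℝ (Fin n))) ↔ (inner ℝ ν y : ℝ) = x := by
      rw [SetLike.mem_coe, AffineSubspace.mem_mk', Submodule.mem_orthogonal_singleton_iff_inner_right]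
      simp [inner_sub_right, inner_smul_right, hν, sub_eq_zero]
    rw [mem_inter_iff, hmem]
    constructor
    · rintro ⟨⟨h1, h2⟩, rfl⟩
      rw [if_pos h2]
      exact ⟨_, h1, by simp⟩
    · intro hy
      split_ifs at hy with hx
      · obtain ⟨z, hz, rfl⟩ := hy
        have : (inner ℝ ν (x • ν + z) : ℝ) = x := by
          rw [inner_add_right, inner_smul_right, hνν, hBν z hz]; ring
        refine ⟨⟨?_, ?_⟩, this⟩
        · rw [this]; simpa using hz
        · rw [this]; exact hx
      · exact hy.elim
  have henorm : ‖ν‖ₑ = 1 := by rw [← ofReal_norm, hν, ENNReal.ofReal_one]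
  rw [key, henorm, one_mul]
  have : ∀ x : ℝ, (Measure.euclideanHausdorffMeasure (n - 1)) (T ∩ (AffineSubspace.mk'
      (x • ν +ᵥ (0 : EuclideanSpace ℝ (Fin n)))
      (Submodule.span ℝ {ν})ᗮ : Set (EuclideanSpace ℝ (Fin n)))) =
      (Ioo (-ε) ε).indicator (fun _ => (Measure.euclideanHausdorffMeasure (n - 1)) B) x := by
    intro x
    rw [hslice, indicator_apply]
    split_ifs
    · exact Isometry.euclideanHausdorffMeasure_image (isometry_add_left _) _
    · simp
  simp_rw [this]
  rw [lintegral_indicator measurableSet_Ioo, lintegral_const, Measure.restrict_apply_univ,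
    Real.volume_Ioo, mul_comm]
  ring_nf

theorem norm_sub_inner_smul_le {E : Type*} [NormedAddCommGroup E] [InnerProductSpace ℝ E] {ν : E}
    (hν : ‖ν‖ = 1) (x : E) : ‖x - (inner ℝ ν x : ℝ) • ν‖ ≤ ‖x‖ := by
  have h : ‖x - (inner ℝ ν x : ℝ) • ν‖ ^ 2 ≤ ‖x‖ ^ 2 := by
    rw [norm_sub_sq_real, inner_smul_right, norm_smul, hν, real_inner_comm, mul_one,
      Real.norm_eq_abs, sq_abs]
    nlinarith [sq_nonneg (inner ℝ ν x : ℝ)]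
  exact le_of_sq_le_sq h (norm_nonneg _)

/-! ### The normal exponential map over an almost flat piece. -/

/-- The normal exponential map of a hypersurface with unit normal field `N`. -/
def normalExp {E : Type*} [AddCommGroup E] [Module ℝ E] (N : E → E) (y : E × ℝ) : E :=
  y.1 + y.2 • N y.1

/-- The normal exponential map of a hyperplane `ν^⊥`, precomposed with the projection to it. -/
def flatExp {E : Type*} [NormedAddCommGroup E] [InnerProductSpace ℝ E] (ν : E) (y : E × ℝ) : E :=
  y.1 - (inner ℝ ν y.1 : ℝ) • ν + y.2 • ν

section Flat

variable {E : Type*} [NormedAddCommGroup E] [InnerProductSpace ℝ E] {ν : E} {N : E → E}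
  {A : Set E} {η L ε : ℝ}

theorem norm_sub_le_of_abs_inner_le (hν : ‖ν‖ = 1) {w : E}
    (h : |(inner ℝ ν w : ℝ)| ≤ η * ‖w‖) :
    (1 - η) * ‖w‖ ≤ ‖w - (inner ℝ ν w : ℝ) • ν‖ := by
  have h2 : ‖w‖ ≤ ‖w - (inner ℝ ν w : ℝ) • ν‖ + |(inner ℝ ν w : ℝ)| := by
    calc ‖w‖ = ‖(w - (inner ℝ ν w : ℝ) • ν) + (inner ℝ ν w : ℝ) • ν‖ := by rw [sub_add_cancel]
      _ ≤ _ := (norm_add_le _ _).trans (by rw [norm_smul, hν, mul_one, Real.norm_eq_abs])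
  linarith

theorem inner_flatExp_sub (hν : ‖ν‖ = 1) (y y' : E × ℝ) :
    (inner ℝ ν (flatExp ν y - flatExp ν y') : ℝ) = y.2 - y'.2 := by
  have hνν : (inner ℝ ν ν : ℝ) = 1 := by
    rw [real_inner_self_eq_norm_sq, hν]
    norm_num
  simp only [flatExp, inner_sub_right, inner_add_right, inner_smul_right, hνν]
  ring

/-- With `D` the difference of the flat images, the error is the sum of the `ν`-component of `q -
q'`, of `t (N q - N q')` and of `(t - t') (N q' - ν)`. The first two are at most `η ‖q - q'‖ ≤ 2 η
‖D‖` each, the last at most `η ‖D‖`; hence the constant 5. The bound on `‖y.1 - y'.1‖` is kept for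
injectivity. -/
theorem norm_normalExp_sub_flatExp_le (hν : ‖ν‖ = 1) (hη0 : 0 ≤ η) (hη : η ≤ 1 / 2)
    (hLε : L * ε ≤ η)
    (h1 : ∀ q ∈ A, ∀ q' ∈ A, |(inner ℝ ν (q - q') : ℝ)| ≤ η * ‖q - q'‖)
    (h2 : ∀ q ∈ A, ‖N q - ν‖ ≤ η)
    (h3 : ∀ q ∈ A, ∀ q' ∈ A, ‖N q - N q'‖ ≤ L * ‖q - q'‖)
    {y y' : E × ℝ} (hy : y ∈ A ×ˢ Ioo (-ε) ε) (hy' : y' ∈ A ×ˢ Ioo (-ε) ε) :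
    ‖y.1 - y'.1‖ ≤ 2 * ‖flatExp ν y - flatExp ν y'‖ ∧
    ‖(normalExp N y - normalExp N y') - (flatExp ν y - flatExp ν y')‖ ≤
      5 * η * ‖flatExp ν y - flatExp ν y'‖ := by
  obtain ⟨q, t⟩ := y
  obtain ⟨q', t'⟩ := y'
  obtain ⟨hq, ht⟩ := hy
  obtain ⟨hq', ht'⟩ := hy'
  simp only at hq hq' ht ht' ⊢
  set D := flatExp ν (q, t) - flatExp ν (q', t') with hD
  have hs : (inner ℝ ν D : ℝ) = t - t' := inner_flatExp_sub hν _ _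
  have hsD : |t - t'| ≤ ‖D‖ := by
    rw [← hs]
    simpa [hν] using abs_real_inner_le_norm ν D
  have hw : D - (inner ℝ ν D : ℝ) • ν = (q - q') - (inner ℝ ν (q - q') : ℝ) • ν := by
    rw [hs, hD, inner_sub_right]
    simp only [flatExp]
    module
  have hwn := norm_sub_le_of_abs_inner_le hν (h1 q hq q' hq')
  have hwD : ‖q - q'‖ ≤ 2 * ‖D‖ := by
    have := norm_sub_inner_smul_le hν D
    rw [hw] at this
    nlinarith [norm_nonneg (q - q')]
  refine ⟨hwD, ?_⟩
  have hdec : (normalExp N (q, t) - normalExp N (q', t')) - D =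
      (inner ℝ ν (q - q') : ℝ) • ν + t • (N q - N q') + (t - t') • (N q' - ν) := by
    rw [hD, inner_sub_right]
    simp only [flatExp, normalExp]
    module
  have htε : |t| ≤ ε := (abs_lt.2 ht).le
  have e1 : ‖(inner ℝ ν (q - q') : ℝ) • ν‖ ≤ η * ‖q - q'‖ := by
    rw [norm_smul, hν, mul_one]
    exact h1 q hq q' hq'
  have e2 : ‖t • (N q - N q')‖ ≤ η * ‖q - q'‖ := by
    rw [norm_smul, Real.norm_eq_abs]
    calc |t| * ‖N q - N q'‖ ≤ ε * (L * ‖q - q'‖) :=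
          mul_le_mul htε (h3 q hq q' hq') (norm_nonneg _) ((abs_nonneg t).trans htε)
      _ = (L * ε) * ‖q - q'‖ := by ring
      _ ≤ _ := by gcongr
  have e3 : ‖(t - t') • (N q' - ν)‖ ≤ ‖D‖ * η := by
    rw [norm_smul, Real.norm_eq_abs]
    exact mul_le_mul hsD (h2 q' hq') (norm_nonneg _) (norm_nonneg _)
  rw [hdec]
  calc _ ≤ η * ‖q - q'‖ + η * ‖q - q'‖ + ‖D‖ * η :=
        (norm_add₃_le).trans (by gcongr)
    _ ≤ η * (2 * ‖D‖) + η * (2 * ‖D‖) + ‖D‖ * η := by gcongr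
    _ = _ := by ring

end Flat

variable {n : ℕ}

/-- Volume of the normal tube over an almost flat piece of a hypersurface. -/
theorem volume_normalExp_image_bounds (hn : 1 ≤ n) {ν : EuclideanSpace ℝ (Fin n)}
    {N : EuclideanSpace ℝ (Fin n) → EuclideanSpace ℝ (Fin n)}
    {A : Set (EuclideanSpace ℝ (Fin n))} {η L ε : ℝ}
    {C : NNReal}
    (hA : MeasurableSet A) (hAb : Bornology.IsBounded A)
    (hν : ‖ν‖ = 1) (hη0 : 0 ≤ η) (hη : η ≤ 1 / 10)
    (hε : 0 < ε) (hLε : L * ε ≤ η) (hC : 1 ≤ C * (1 - 5 * η))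
    (h1 : ∀ q ∈ A, ∀ q' ∈ A, |(inner ℝ ν (q - q') : ℝ)| ≤ η * ‖q - q'‖)
    (h2 : ∀ q ∈ A, ‖N q - ν‖ ≤ η)
    (h3 : ∀ q ∈ A, ∀ q' ∈ A, ‖N q - N q'‖ ≤ L * ‖q - q'‖) :
    InjOn (normalExp N) (A ×ˢ Ioo (-ε) ε) ∧
    Measure.euclideanHausdorffMeasure (n - 1) A < ⊤ ∧
    volume (normalExp N '' (A ×ˢ Ioo (-ε) ε)) ≤
      (C : ℝ≥0∞) ^ (2 * n) *
        (ENNReal.ofReal (2 * ε) * Measure.euclideanHausdorffMeasure (n - 1) A) ∧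
    ENNReal.ofReal (2 * ε) * Measure.euclideanHausdorffMeasure (n - 1) A ≤
      (C : ℝ≥0∞) ^ (2 * n) * volume (normalExp N '' (A ×ˢ Ioo (-ε) ε)) := by
  have hνν : (inner ℝ ν ν : ℝ) = 1 := by
    rw [real_inner_self_eq_norm_sq, hν]
    norm_num
  have hC1 : (1 : ℝ) ≤ C := by
    have : (C : ℝ) * (1 - 5 * η) ≤ C := by nlinarith [C.coe_nonneg]
    linarith
  have hC1' : (1 : ℝ≥0∞) ≤ C := by exact_mod_cast hC1
  have hclose := fun {y y' : EuclideanSpace ℝ (Fin n) × ℝ} hy hy' =>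
    norm_normalExp_sub_flatExp_le (y := y) (y' := y') hν hη0 (by linarith : η ≤ 1 / 2) hLε
      h1 h2 h3 hy hy'
  set π : EuclideanSpace ℝ (Fin n) → EuclideanSpace ℝ (Fin n) :=
    fun q => q - (inner ℝ ν q : ℝ) • ν with hπ
  have hπsub : ∀ q q', π q - π q' = (q - q') - (inner ℝ ν (q - q') : ℝ) • ν := by
    intro q q'
    simp only [hπ, inner_sub_right]
    module
  have hπlip : ∀ q q', dist (π q) (π q') ≤ dist q q' := by
    intro q q'
    rw [dist_eq_norm, dist_eq_norm, hπsub]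
    exact norm_sub_inner_smul_le hν _
  have hπanti : ∀ q ∈ A, ∀ q' ∈ A, dist q q' ≤ C * dist (π q) (π q') := by
    intro q hq q' hq'
    rw [dist_eq_norm, dist_eq_norm, hπsub]
    have := norm_sub_le_of_abs_inner_le hν (h1 q hq q' hq')
    have h5 : ‖q - q'‖ ≤ C * (1 - 5 * η) * ‖q - q'‖ := le_mul_of_one_le_left (norm_nonneg _) hC
    have h6 : (1 - 5 * η) * ‖q - q'‖ ≤ (1 - η) * ‖q - q'‖ := by gcongr; linarith
    calc ‖q - q'‖ ≤ C * ((1 - 5 * η) * ‖q - q'‖) := by linarith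
      _ ≤ _ := by gcongr; linarith
  have hπinj : InjOn π A := by
    intro q hq q' hq' h
    have := hπanti q hq q' hq'
    rw [h, dist_self, mul_zero] at this
    exact dist_le_zero.1 this
  have hπc : Continuous π := by fun_prop
  have hπA : MeasurableSet (π '' A) := hA.image_of_continuousOn_injOn hπc.continuousOn hπinj
  have hP : flatExp ν '' (A ×ˢ Ioo (-ε) ε) = {x : EuclideanSpace ℝ (Fin n) |
      x - (inner ℝ ν x : ℝ) • ν ∈ π '' A ∧ (inner ℝ ν x : ℝ) ∈ Ioo (-ε) ε} := by
    ext x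
    constructor
    · rintro ⟨⟨q, t⟩, ⟨hq, ht⟩, rfl⟩
      have : (inner ℝ ν (flatExp ν (q, t)) : ℝ) = t := by
        simp only [flatExp, inner_sub_right, inner_add_right, inner_smul_right, hνν]
        ring
      refine ⟨⟨q, hq, ?_⟩, ?_⟩
      · rw [this]
        simp [flatExp, hπ]
      · rw [this]
        exact ht
    · rintro ⟨⟨q, hq, hqx⟩, ht⟩
      refine ⟨(q, inner ℝ ν x), ⟨hq, ht⟩, ?_⟩
      have : q - (inner ℝ ν q : ℝ) • ν = x - (inner ℝ ν x : ℝ) • ν := hqx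
      simp only [flatExp, this, sub_add_cancel]
  have hslab : volume (flatExp ν '' (A ×ˢ Ioo (-ε) ε)) =
      ENNReal.ofReal (2 * ε) * Measure.euclideanHausdorffMeasure (n - 1) (π '' A) := by
    rw [hP]
    refine volume_slab hν hπA ?_ ε
    rintro _ ⟨q, -, rfl⟩
    simp [hπ, inner_sub_right, inner_smul_right, hν]
  have hFP : ∀ y ∈ A ×ˢ Ioo (-ε) ε, ∀ y' ∈ A ×ˢ Ioo (-ε) ε,
      dist (normalExp N y) (normalExp N y') ≤ C * dist (flatExp ν y) (flatExp ν y') := by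
    intro y hy y' hy'
    rw [dist_eq_norm, dist_eq_norm]
    have h := (hclose hy hy').2
    have h' := norm_le_norm_add_norm_sub' (normalExp N y - normalExp N y')
      (flatExp ν y - flatExp ν y')
    -- This follows from `(1 + 5 η) (1 - 5 η) ≤ 1 ≤ C (1 - 5 η)`, so one `C` serves both directions.
    have : 1 + 5 * η ≤ C := by
      by_contra! hlt
      nlinarith
    nlinarith [norm_nonneg (flatExp ν y - flatExp ν y')]
  have hPF : ∀ y ∈ A ×ˢ Ioo (-ε) ε, ∀ y' ∈ A ×ˢ Ioo (-ε) ε,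
      dist (flatExp ν y) (flatExp ν y') ≤ C * dist (normalExp N y) (normalExp N y') := by
    intro y hy y' hy'
    rw [dist_eq_norm, dist_eq_norm]
    have h := (hclose hy hy').2
    have h' := norm_le_norm_add_norm_sub (normalExp N y - normalExp N y')
      (flatExp ν y - flatExp ν y')
    set d := ‖flatExp ν y - flatExp ν y'‖
    have h5 : d ≤ C * (1 - 5 * η) * d := le_mul_of_one_le_left (norm_nonneg _) hC
    have h6 : (1 - 5 * η) * d ≤ ‖normalExp N y - normalExp N y'‖ := by linarith
    nlinarith [C.coe_nonneg]
  have hvol := (EuclideanSpace.euclideanHausdorffMeasure_eq_volume n)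
  have m1 := euclideanHausdorffMeasure_image_le_of_dist_le n hFP
  have m2 := euclideanHausdorffMeasure_image_le_of_dist_le n hPF
  rw [hvol, hslab] at m1 m2
  have m3 := euclideanHausdorffMeasure_image_le_of_dist_le (n - 1) (f := id) (g := π) (s := A)
    (C := C) hπanti
  have m4 := euclideanHausdorffMeasure_image_le_of_dist_le (n - 1) (f := π) (g := id) (s := A)
    (C := 1) (fun q _ q' _ => by simpa using hπlip q q')
  rw [image_id] at m3 m4
  rw [ENNReal.coe_one, one_pow, one_mul] at m4
  refine ⟨?_, ?_, ?_, ?_⟩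
  -- Equal images force equal flat images; the `ν`-component then gives `t = t'`, and the first
  -- bound of `hclose` gives `q = q'`.
  · intro y hy y' hy' h
    have h0 := hPF y hy y' hy'
    rw [h, dist_self, mul_zero] at h0
    have h00 : flatExp ν y - flatExp ν y' = 0 := by rw [dist_le_zero.1 h0, sub_self]
    have ht := inner_flatExp_sub hν y y'
    have hq := (hclose hy hy').1
    rw [h00, inner_zero_right] at ht
    rw [h00, norm_zero, mul_zero] at hq
    exact Prod.ext (sub_eq_zero.1 (norm_le_zero_iff.1 hq)) (sub_eq_zero.1 ht.symm)
  -- The flat slab is bounded, so its volume, `2 ε` times the area of `π '' A`, is finite; the area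
  -- of `A` is at most `C ^ (n - 1)` times that of `π '' A`.
  · have hb : Bornology.IsBounded (flatExp ν '' (A ×ˢ Ioo (-ε) ε)) := by
      have : LipschitzWith 1 π := LipschitzWith.of_dist_le_mul (by simpa using hπlip)
      have hbA : Bornology.IsBounded (π '' A) := this.isBounded_image hAb
      obtain ⟨R, hR⟩ := hbA.exists_norm_le
      refine isBounded_iff_forall_norm_le.2 ⟨R + ε, ?_⟩
      rintro _ ⟨⟨q, t⟩, ⟨hq, ht⟩, rfl⟩
      refine (norm_add_le _ _).trans (add_le_add (hR _ ⟨q, hq, rfl⟩) ?_)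
      rw [norm_smul, hν, mul_one]
      exact (abs_lt.2 ht).le
    have hfin := hb.measure_lt_top (μ := (volume : Measure (EuclideanSpace ℝ (Fin n))))
    rw [hslab] at hfin
    have hπfin : Measure.euclideanHausdorffMeasure (n - 1) (π '' A) < ⊤ := by
      by_contra! htop
      rw [top_le_iff.1 htop, ENNReal.mul_top (by simpa using hε)] at hfin
      exact lt_irrefl _ hfin
    exact m3.trans_lt (ENNReal.mul_lt_top (by finiteness) hπfin)
  · calc _ ≤ _ := m1
      _ ≤ (C : ℝ≥0∞) ^ (2 * n) * (ENNReal.ofReal (2 * ε) *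
          Measure.euclideanHausdorffMeasure (n - 1) A) := 
        mul_le_mul' (pow_le_pow_right₀ hC1' (by omega)) (by gcongr)
  · calc _ ≤ ENNReal.ofReal (2 * ε) * ((C : ℝ≥0∞) ^ (n - 1) *
          Measure.euclideanHausdorffMeasure (n - 1) (π '' A)) := by gcongr
      _ = (C : ℝ≥0∞) ^ (n - 1) * (ENNReal.ofReal (2 * ε) *
          Measure.euclideanHausdorffMeasure (n - 1) (π '' A)) := by ring
      _ ≤ (C : ℝ≥0∞) ^ (n - 1) * ((C : ℝ≥0∞) ^ n *
          volume (normalExp N '' (A ×ˢ Ioo (-ε) ε))) := by gcongr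
      _ = (C : ℝ≥0∞) ^ (n - 1 + n) * volume (normalExp N '' (A ×ˢ Ioo (-ε) ε)) := by
        rw [pow_add, mul_assoc]
      _ ≤ _ := by
        gcongr ?_ * _
        exact pow_le_pow_right₀ hC1' (by omega)

/-! ### Tubes around compact hypersurfaces: from local to global. -/

/-- `N` is a unit normal field of the hypersurface `S`: it is locally Lipschitz, and near each point
`S` is to first order orthogonal to it. -/
structure IsUnitNormalField {E : Type*} [NormedAddCommGroup E] [InnerProductSpace ℝ E]
    (S : Set E) (N : E → E) : Prop where
  norm_eq_one : ∀ p ∈ S, ‖N p‖ = 1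
  abs_inner_le : ∀ p ∈ S, ∀ δ : ℝ, 0 < δ → ∃ r : ℝ, 0 < r ∧ ∀ q ∈ S ∩ Metric.ball p r,
    ∀ q' ∈ S ∩ Metric.ball p r, |(inner ℝ (N p) (q - q') : ℝ)| ≤ δ * ‖q - q'‖
  lipschitz : ∀ p ∈ S, ∃ r : ℝ, 0 < r ∧ ∃ L : ℝ, ∀ q ∈ S ∩ Metric.ball p r,
    ∀ q' ∈ S ∩ Metric.ball p r, ‖N q - N q'‖ ≤ L * ‖q - q'‖

/-- `A` has finite area, and the volume of its normal tube of radius `ε` is `2 ε` times that area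
up to a factor `M`. -/
def TubeBounds {n : ℕ} (N : EuclideanSpace ℝ (Fin n) → EuclideanSpace ℝ (Fin n)) (M : NNReal)
    (ε : ℝ) (A : Set (EuclideanSpace ℝ (Fin n))) : Prop :=
  Measure.euclideanHausdorffMeasure (n - 1) A < ⊤ ∧
    volume (normalExp N '' (A ×ˢ Ioo (-ε) ε)) ≤
      M * (ENNReal.ofReal (2 * ε) * Measure.euclideanHausdorffMeasure (n - 1) A) ∧
    ENNReal.ofReal (2 * ε) * Measure.euclideanHausdorffMeasure (n - 1) A ≤
      M * volume (normalExp N '' (A ×ˢ Ioo (-ε) ε))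

variable {n : ℕ}

namespace IsUnitNormalField

variable {S : Set (EuclideanSpace ℝ (Fin n))}
  {N : EuclideanSpace ℝ (Fin n) → EuclideanSpace ℝ (Fin n)}

theorem continuousOn (hN : IsUnitNormalField S N) : ContinuousOn N S := by
  intro p hp
  obtain ⟨r, hr, L, hL⟩ := hN.lipschitz p hp
  have hlip : LipschitzOnWith L.toNNReal N (S ∩ Metric.ball p r) := by
    refine LipschitzOnWith.of_dist_le_mul fun q hq q' hq' => ?_
    rw [dist_eq_norm, dist_eq_norm]
    exact (hL q hq q' hq').trans (by gcongr; exact Real.le_coe_toNNReal L)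
  have := hlip.continuousOn p ⟨hp, Metric.mem_ball_self hr⟩
  exact (continuousWithinAt_inter (Metric.ball_mem_nhds p hr)).1 this

theorem exists_tubeBounds_ball (hn : 1 ≤ n) (hN : IsUnitNormalField S N) {M : NNReal} (hM : 1 < M)
    {p : EuclideanSpace ℝ (Fin n)} (hp : p ∈ S) :
    ∃ r : ℝ, 0 < r ∧ ∃ ε₀ : ℝ, 0 < ε₀ ∧ ∀ ε : ℝ, 0 < ε → ε < ε₀ →
      ∀ A : Set (EuclideanSpace ℝ (Fin n)), MeasurableSet A → A ⊆ S ∩ Metric.ball p r →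
        InjOn (normalExp N) (A ×ˢ Ioo (-ε) ε) ∧ TubeBounds N M ε A := by
  obtain ⟨η, hη0, hη1, hηM⟩ : ∃ η : ℝ, 0 < η ∧ η < 1 / 10 ∧ ((1 - 5 * η)⁻¹) ^ (2 * n) < M := by
    have hc : ContinuousAt (fun η : ℝ => ((1 - 5 * η)⁻¹) ^ (2 * n)) 0 := by
      refine ContinuousAt.pow (ContinuousAt.inv₀ (by fun_prop) (by norm_num)) _
    have h1 : ∀ᶠ η : ℝ in 𝓝[>] 0, ((1 - 5 * η)⁻¹) ^ (2 * n) < M := by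
      refine Filter.Eventually.filter_mono nhdsWithin_le_nhds (hc.eventually_lt_const ?_)
      simpa using hM
    have h2 : ∀ᶠ η : ℝ in 𝓝[>] 0, η < 1 / 10 :=
      (eventually_lt_nhds (by norm_num)).filter_mono nhdsWithin_le_nhds
    obtain ⟨η, h, h', h''⟩ := (h1.and (h2.and self_mem_nhdsWithin)).exists
    exact ⟨η, h'', h', h⟩
  obtain ⟨r₁, hr₁, h1⟩ := hN.abs_inner_le p hp η hη0
  obtain ⟨r₂, hr₂, L, hL⟩ := hN.lipschitz p hp
  set L' := max L 0 with hL'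
  have hL'0 : 0 ≤ L' := le_max_right _ _
  -- The `+ 1` avoids division by zero. As `ε₀` also bounds the radius of the ball, `L' * ε₀ ≤ η`
  -- controls both `L' * ε` and `‖N q - N p‖`.
  set ε₀ := η / (L' + 1) with hε₀
  have hε₀pos : 0 < ε₀ := by positivity
  have hLε₀ : L' * ε₀ ≤ η := by
    rw [hε₀, mul_div_assoc', div_le_iff₀ (by positivity)]
    nlinarith
  refine ⟨min (min r₁ r₂) ε₀, by positivity, ε₀, hε₀pos, fun ε hε hε' A hA hAS => ?_⟩
  have hA1 : A ⊆ S ∩ Metric.ball p r₁ := hAS.trans (by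
    gcongr
    exact (min_le_left _ _).trans (min_le_left _ _))
  have hA2 : A ⊆ S ∩ Metric.ball p r₂ := hAS.trans (by
    gcongr
    exact (min_le_left _ _).trans (min_le_right _ _))
  have hlip : ∀ q ∈ S ∩ Metric.ball p r₂, ∀ q' ∈ S ∩ Metric.ball p r₂,
      ‖N q - N q'‖ ≤ L' * ‖q - q'‖ := fun q hq q' hq' =>
    (hL q hq q' hq').trans (by gcongr; exact le_max_left _ _)
  have hpos : 0 < 1 - 5 * η := by linarith
  set C : NNReal := ⟨(1 - 5 * η)⁻¹, by positivity⟩ with hC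
  have hCM : C ^ (2 * n) ≤ M := by
    rw [← NNReal.coe_le_coe]
    push_cast
    exact hηM.le
  have hCM' : (C : ℝ≥0∞) ^ (2 * n) ≤ M := by exact_mod_cast hCM
  obtain ⟨a, b, c, d⟩ := volume_normalExp_image_bounds (L := L') (C := C) (N := N) hn hA
    (Metric.isBounded_ball.subset (hAS.trans inter_subset_right)) (hN.norm_eq_one p hp) hη0.le
    hη1.le hε ((mul_le_mul_of_nonneg_left hε'.le hL'0).trans hLε₀)
    (by
      change 1 ≤ (1 - 5 * η)⁻¹ * (1 - 5 * η)
      rw [inv_mul_cancel₀ hpos.ne'])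
    (fun q hq q' hq' => h1 q (hA1 hq) q' (hA1 hq'))
    (fun q hq => by
      refine (hlip q (hA2 hq) p ⟨hp, Metric.mem_ball_self hr₂⟩).trans ?_
      have : ‖q - p‖ ≤ ε₀ := by
        rw [← dist_eq_norm]
        exact (Metric.mem_ball.1 (hAS hq).2).le.trans (min_le_right _ _)
      exact (mul_le_mul_of_nonneg_left this hL'0).trans hLε₀)
    (fun q hq q' hq' => hlip q (hA2 hq) q' (hA2 hq'))
  exact ⟨a, b, c.trans (by gcongr), d.trans (by gcongr)⟩

/-- Both base points are closer than `ε` to the common image. This reduces global injectivity to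
injectivity on small balls. -/
theorem norm_sub_le_of_normalExp_eq (hN : IsUnitNormalField S N) {ε : ℝ}
    {y y' : EuclideanSpace ℝ (Fin n) × ℝ}
    (hy : y ∈ S ×ˢ Ioo (-ε) ε) (hy' : y' ∈ S ×ˢ Ioo (-ε) ε)
    (h : normalExp N y = normalExp N y') : ‖y'.1 - y.1‖ < 2 * ε := by
  have : y'.1 - y.1 = y.2 • N y.1 - y'.2 • N y'.1 := by
    rw [sub_eq_sub_iff_add_eq_add, add_comm (y.2 • N y.1)]
    exact h.symm
  rw [this]
  refine (norm_sub_le _ _).trans_lt ?_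
  rw [norm_smul, norm_smul, hN.norm_eq_one _ hy.1, hN.norm_eq_one _ hy'.1, Real.norm_eq_abs,
    Real.norm_eq_abs]
  linarith [abs_lt.2 hy.2, abs_lt.2 hy'.2]

/-- Finitely many of the local balls suffice. Once the normal map is injective on all of `S`,
disjoint pieces have disjoint tubes, so the bounds add up without loss in `M`. -/
theorem exists_injOn_tubeBounds (hn : 1 ≤ n) (hS : IsCompact S) (hN : IsUnitNormalField S N)
    {M : NNReal} (hM : 1 < M) : ∃ ε₀ : ℝ, 0 < ε₀ ∧ ∀ ε : ℝ, 0 < ε → ε < ε₀ →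
      InjOn (normalExp N) (S ×ˢ Ioo (-ε) ε) ∧ TubeBounds N M ε S := by
  classical
  have hloc : ∀ p : S, ∃ r : ℝ, 0 < r ∧ ∃ ε₀ : ℝ, 0 < ε₀ ∧ ∀ ε : ℝ, 0 < ε → ε < ε₀ →
      ∀ A : Set (EuclideanSpace ℝ (Fin n)), MeasurableSet A →
        A ⊆ S ∩ Metric.ball (p : EuclideanSpace ℝ (Fin n)) r →
        InjOn (normalExp N) (A ×ˢ Ioo (-ε) ε) ∧ TubeBounds N M ε A :=
    fun p => hN.exists_tubeBounds_ball hn hM p.2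
  choose r hr e he hb using hloc
  obtain ⟨t, ht⟩ := hS.elim_finite_subcover
    (fun p : S => Metric.ball (p : EuclideanSpace ℝ (Fin n)) (r p / 2))
    (fun _ => Metric.isOpen_ball)
    (fun p hp => mem_iUnion.2 ⟨⟨p, hp⟩, Metric.mem_ball_self (half_pos (hr _))⟩)
  have hSm : MeasurableSet S := hS.measurableSet
  -- The half-radius balls cover `S`, and `r p / 2 + 2 ε ≤ r p` once `ε ≤ r p / 4`: two points with
  -- the same image lie in one full ball.
  have hmin : ∃ ε₀ : ℝ, 0 < ε₀ ∧ ∀ p ∈ t, ε₀ ≤ e p ∧ ε₀ ≤ r p / 4 := by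
    clear ht
    induction t using Finset.induction_on with
    | empty => exact ⟨1, one_pos, by simp⟩
    | insert p t _ ih =>
      obtain ⟨ε₀, h0, h⟩ := ih
      have hrp := hr p
      have hep := he p
      refine ⟨min ε₀ (min (e p) (r p / 4)), by positivity, fun q hq => ?_⟩
      rcases Finset.mem_insert.1 hq with rfl | hq
      · exact ⟨(min_le_right _ _).trans (min_le_left _ _),
          (min_le_right _ _).trans (min_le_right _ _)⟩
      · exact ⟨(min_le_left _ _).trans (h q hq).1, (min_le_left _ _).trans (h q hq).2⟩
  obtain ⟨ε₀, hε₀, hmin⟩ := hmin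
  refine ⟨ε₀, hε₀, fun ε hε hεlt => ?_⟩
  have hinj : InjOn (normalExp N) (S ×ˢ Ioo (-ε) ε) := by
    intro y hy y' hy' h
    obtain ⟨p, hpt, hyp⟩ := mem_iUnion₂.1 (ht hy.1)
    have hd := hN.norm_sub_le_of_normalExp_eq hy hy' h
    have h4 := (hmin p hpt).2
    rw [Metric.mem_ball] at hyp
    have hyb : y.1 ∈ S ∩ Metric.ball (p : EuclideanSpace ℝ (Fin n)) (r p) :=
      ⟨hy.1, Metric.mem_ball.2 (hyp.trans (half_lt_self (hr p)))⟩
    have hyb' : y'.1 ∈ S ∩ Metric.ball (p : EuclideanSpace ℝ (Fin n)) (r p) := by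
      refine ⟨hy'.1, Metric.mem_ball.2 ?_⟩
      have := dist_triangle y'.1 y.1 p
      rw [dist_eq_norm y'.1 y.1] at this
      linarith
    exact (hb p ε hε (hεlt.trans_le (hmin p hpt).1) _ (hSm.inter Metric.isOpen_ball.measurableSet)
      subset_rfl).1 ⟨hyb, hy.2⟩ ⟨hyb', hy'.2⟩ h
  have hcont : ContinuousOn (normalExp N) (S ×ˢ Ioo (-ε) ε) :=
    continuousOn_fst.add (continuousOn_snd.smul
      (hN.continuousOn.comp continuousOn_fst fun y hy => hy.1))
  have hunion : ∀ A B : Set (EuclideanSpace ℝ (Fin n)), MeasurableSet A → MeasurableSet B →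
      A ⊆ S → B ⊆ S → Disjoint A B →
      TubeBounds N M ε A → TubeBounds N M ε B → TubeBounds N M ε (A ∪ B) := by
    rintro A B hA hB hAS hBS hAB ⟨a1, a2, a3⟩ ⟨b1, b2, b3⟩
    have hBI : MeasurableSet (normalExp N '' (B ×ˢ Ioo (-ε) ε)) :=
      (hB.prod measurableSet_Ioo).image_of_continuousOn_injOn
        (hcont.mono (prod_mono hBS subset_rfl)) (hinj.mono (prod_mono hBS subset_rfl))
    have hdisj : Disjoint (normalExp N '' (A ×ˢ Ioo (-ε) ε)) (normalExp N '' (B ×ˢ Ioo (-ε) ε)) :=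
      disjoint_image_image fun y hy y' hy' h => disjoint_left.1 hAB hy.1
        (hinj ⟨hAS hy.1, hy.2⟩ ⟨hBS hy'.1, hy'.2⟩ h ▸ hy'.1)
    refine ⟨?_, ?_, ?_⟩
    · rw [measure_union hAB hB]
      exact ENNReal.add_lt_top.2 ⟨a1, b1⟩
    · rw [union_prod, image_union, measure_union hdisj hBI, measure_union hAB hB, mul_add, mul_add]
      exact add_le_add a2 b2
    · rw [union_prod, image_union, measure_union hdisj hBI, measure_union hAB hB, mul_add, mul_add]
      exact add_le_add a3 b3
  have hfin : ∀ u : Finset S, u ⊆ t → ∀ A : Set (EuclideanSpace ℝ (Fin n)), MeasurableSet A → A ⊆ S →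
      A ⊆ ⋃ p ∈ u, Metric.ball (p : EuclideanSpace ℝ (Fin n)) (r p / 2) → TubeBounds N M ε A := by
    intro u
    induction u using Finset.induction_on with
    | empty =>
      intro _ A _ _ hAu
      have : A = ∅ := by simpa [subset_empty_iff] using hAu
      subst this
      simp [TubeBounds]
    | insert p u _ ih =>
      intro hut A hA hAS hAu
      -- Cut off the part of `A` in one full ball; the rest misses the half ball too, so the
      -- remaining balls cover it.
      rw [← inter_union_sdiff A (Metric.ball (p : EuclideanSpace ℝ (Fin n)) (r p))]
      have hball : MeasurableSet (Metric.ball (p : EuclideanSpace ℝ (Fin n)) (r p)) :=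
        Metric.isOpen_ball.measurableSet
      refine hunion _ _ (hA.inter hball) (hA.diff hball) (inter_subset_left.trans hAS)
        (sdiff_subset.trans hAS) (disjoint_sdiff_right.mono_left inter_subset_right) ?_ ?_
      · have hpt := hut (Finset.mem_insert_self p u)
        exact (hb p ε hε (hεlt.trans_le (hmin p hpt).1) _ (hA.inter hball)
          (inter_subset_inter_left _ hAS)).2
      · refine ih ((Finset.subset_insert p u).trans hut) _ (hA.diff hball)
          (sdiff_subset.trans hAS) ?_
        rintro x ⟨hxA, hxp⟩
        have := hAu hxA
        rw [Finset.set_biUnion_insert] at this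
        rcases this with h | h
        · exact absurd (Metric.ball_subset_ball (half_le_self (hr p).le) h) hxp
        · exact h
  exact ⟨hinj, hfin t subset_rfl S hSm subset_rfl ht⟩

theorem measure_lt_top (hn : 1 ≤ n) (hS : IsCompact S) (hN : IsUnitNormalField S N) :
    Measure.euclideanHausdorffMeasure (n - 1) S < ⊤ := by
  obtain ⟨ε₀, hε₀, h⟩ := hN.exists_injOn_tubeBounds hn hS (M := 2) (by norm_num)
  exact (h (ε₀ / 2) (half_pos hε₀) (half_lt_self hε₀)).2.1

/-- For each `M > 1` the quotient eventually lies between `μ / M` and `M * μ`. Since `μ` is finite,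
`M * a → a` as `M → 1` for the values `a` that occur. -/
theorem tendsto_volume_div (hn : 1 ≤ n) (hS : IsCompact S) (hN : IsUnitNormalField S N) :
    Tendsto (fun ε : ℝ => volume (normalExp N '' (S ×ˢ Ioo (-ε) ε)) / ENNReal.ofReal (2 * ε))
      (𝓝[>] 0) (𝓝 (Measure.euclideanHausdorffMeasure (n - 1) S)) := by
  set μ := Measure.euclideanHausdorffMeasure (n - 1) S with hμ
  have hμtop : μ ≠ ⊤ := (hN.measure_lt_top hn hS).ne
  have hev : ∀ M : NNReal, 1 < M → ∀ᶠ ε : ℝ in 𝓝[>] 0,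
      volume (normalExp N '' (S ×ˢ Ioo (-ε) ε)) / ENNReal.ofReal (2 * ε) ≤ M * μ ∧
      μ ≤ M * (volume (normalExp N '' (S ×ˢ Ioo (-ε) ε)) / ENNReal.ofReal (2 * ε)) := by
    intro M hM
    obtain ⟨ε₀, hε₀, h⟩ := hN.exists_injOn_tubeBounds hn hS hM
    filter_upwards [Ioo_mem_nhdsGT hε₀] with ε hε
    obtain ⟨-, -, h1, h2⟩ := h ε hε.1 hε.2
    have hpos : ENNReal.ofReal (2 * ε) ≠ 0 := by
      simpa using hε.1
    refine ⟨?_, ?_⟩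
    · refine ENNReal.div_le_of_le_mul (h1.trans_eq ?_)
      ring
    · rw [← mul_div_assoc, ENNReal.le_div_iff_mul_le (Or.inl hpos) (Or.inl ENNReal.ofReal_ne_top),
        mul_comm]
      exact h2
  have hcont : ∀ a : ℝ≥0∞, a ≠ ⊤ → Tendsto (fun M : NNReal => (M : ℝ≥0∞) * a) (𝓝[>] 1) (𝓝 a) := by
    intro a ha
    have h1 : Tendsto (fun M : NNReal => (M : ℝ≥0∞) * a) (𝓝 1) (𝓝 (((1 : NNReal) : ℝ≥0∞) * a)) :=
      ENNReal.Tendsto.mul_const (ENNReal.tendsto_coe.2 tendsto_id) (Or.inr ha)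
    rw [ENNReal.coe_one, one_mul] at h1
    exact h1.mono_left nhdsWithin_le_nhds
  refine tendsto_order.2 ⟨fun a ha => ?_, fun b hb => ?_⟩
  · obtain ⟨M, hMa, hM⟩ := (((hcont a ha.ne_top).eventually_lt_const ha).and
      self_mem_nhdsWithin).exists
    filter_upwards [hev M hM] with ε hε
    by_contra! hle
    exact (hε.2.trans (by gcongr)).not_gt hMa
  · obtain ⟨M, hMb, hM⟩ := (((hcont μ hμtop).eventually_lt_const hb).and
      self_mem_nhdsWithin).exists
    filter_upwards [hev M hM] with ε hε
    exact hε.1.trans_lt hMb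

end IsUnitNormalField

/-! ### Smooth boundaries: tangent spaces and the outward normal. -/

theorem eventually_pos_of_fderiv_pos {E : Type*} [NormedAddCommGroup E] [NormedSpace ℝ E]
    {f : E → ℝ} {f' : E →L[ℝ] ℝ} {q u : E} (hf : HasFDerivAt f f' q) (hq : f q = 0)
    (hu : 0 < f' u) : ∀ᶠ t : ℝ in 𝓝[>] 0, 0 < f (q + t • u) := by
  have h1 : HasDerivAt (fun t : ℝ => q + t • u) u 0 := by
    simpa using ((hasDerivAt_id (0 : ℝ)).smul_const u).const_add q
  have hf0 : HasFDerivAt f f' (q + (0 : ℝ) • u) := by simpa using hf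
  have h2 : HasDerivAt (fun t : ℝ => f (q + t • u)) (f' u) 0 := hf0.comp_hasDerivAt (0 : ℝ) h1
  have h3 := (hasDerivAt_iff_tendsto_slope_zero.1 h2).mono_left
    (nhdsWithin_mono (0 : ℝ) fun t (ht : 0 < t) => ht.ne')
  filter_upwards [h3.eventually_const_lt hu, self_mem_nhdsWithin] with t ht ht0
  simp only [zero_add, zero_smul, add_zero, hq, sub_zero, smul_eq_mul] at ht
  exact (mul_pos_iff_of_pos_left (inv_pos.2 ht0)).1 ht

/-- On the open set `U`, the set `K` is the sublevel set `{φ ≤ 0}` of a smooth function without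
critical points. -/
structure IsDefiningFunctionOn {n : ℕ} (K U : Set (EuclideanSpace ℝ (Fin n)))
    (φ : EuclideanSpace ℝ (Fin n) → ℝ) : Prop where
  isOpen : IsOpen U
  contDiffOn : ContDiffOn ℝ ∞ φ U
  fderiv_ne_zero : ∀ x ∈ U, fderiv ℝ φ x ≠ 0
  mem_iff : ∀ x ∈ U, x ∈ K ↔ φ x ≤ 0

namespace IsDefiningFunctionOn

variable {n : ℕ} {K U : Set (EuclideanSpace ℝ (Fin n))} {φ : EuclideanSpace ℝ (Fin n) → ℝ}
  {q : EuclideanSpace ℝ (Fin n)}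

theorem contDiffAt (h : IsDefiningFunctionOn K U φ) (hq : q ∈ U) : ContDiffAt ℝ ∞ φ q :=
  h.contDiffOn.contDiffAt (h.isOpen.mem_nhds hq)

theorem hasStrictFDerivAt (h : IsDefiningFunctionOn K U φ) (hq : q ∈ U) :
    HasStrictFDerivAt φ (fderiv ℝ φ q) q :=
  (h.contDiffAt hq).hasStrictFDerivAt (by simp)

/-- A zero of `φ` interior to `K` would be a local maximum of `φ`, hence a critical point. -/
theorem mem_frontier_iff (h : IsDefiningFunctionOn K U φ) (hq : q ∈ U) :
    q ∈ frontier K ↔ φ q = 0 := by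
  have hc : ContinuousAt φ q := (h.contDiffAt hq).continuousAt
  have hU : ∀ᶠ x in 𝓝 q, x ∈ U := h.isOpen.mem_nhds hq
  constructor
  · rintro ⟨hcl, hint⟩
    rcases lt_trichotomy (φ q) 0 with hlt | heq | hgt
    · refine absurd (mem_interior_iff_mem_nhds.2 ?_) hint
      filter_upwards [hc.eventually_lt_const hlt, hU] with x hx hxU
      exact (h.mem_iff x hxU).2 hx.le
    · exact heq
    · obtain ⟨x, hxK, hx, hxU⟩ :=
        ((mem_closure_iff_frequently.1 hcl).and_eventually
          ((hc.eventually_const_lt hgt).and hU)).exists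
      exact absurd ((h.mem_iff x hxU).1 hxK) hx.not_ge
  · intro h0
    refine ⟨subset_closure ((h.mem_iff q hq).2 h0.le), fun hint => h.fderiv_ne_zero q hq ?_⟩
    refine IsLocalMax.fderiv_eq_zero ?_
    filter_upwards [mem_interior_iff_mem_nhds.1 hint, hU] with x hx hxU
    rw [h0]
    exact (h.mem_iff x hxU).1 hx

theorem gradient_ne_zero (h : IsDefiningFunctionOn K U φ) (hq : q ∈ U) : gradient φ q ≠ 0 := by
  intro h0
  refine h.fderiv_ne_zero q hq ?_
  rw [← toDual_gradient, h0, map_zero]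

/-- Velocities of curves in the zero set are killed by `fderiv ℝ φ q`. Conversely, the implicit
function theorem makes each kernel vector `w` the velocity of a curve in the level set, the image of
the line `t • w`. -/
theorem tangentSpaceAt_eq (h : IsDefiningFunctionOn K U φ) (hq : q ∈ U) (hqK : q ∈ frontier K) :
    tangentSpaceAt (frontier K) q = (Submodule.span ℝ {gradient φ q})ᗮ := by
  have hs := h.hasStrictFDerivAt hq
  have hφq := (h.mem_frontier_iff hq).1 hqK
  apply le_antisymm
  · refine Submodule.span_le.2 ?_
    rintro v ⟨γ, hγ0, hγ, hγv⟩
    rw [SetLike.mem_coe, Submodule.mem_orthogonal_singleton_iff_inner_right, inner_gradient_left]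
    have hd : HasDerivAt (fun t => φ (γ t)) (fderiv ℝ φ q v) 0 := by
      have hs' := hs.hasFDerivAt
      rw [← hγ0] at hs' ⊢
      exact hs'.comp_hasDerivAt (0 : ℝ) hγv
    have hz : (fun t => φ (γ t)) =ᶠ[𝓝 0] fun _ => (0 : ℝ) := by
      have hU : ∀ᶠ t in 𝓝 0, γ t ∈ U :=
        hγv.continuousAt.eventually_mem (by rw [hγ0]; exact h.isOpen.mem_nhds hq)
      filter_upwards [hγ, hU] with t ht htU
      exact (h.mem_frontier_iff htU).1 ht
    exact hd.unique ((hasDerivAt_const (0 : ℝ) (0 : ℝ)).congr_of_eventuallyEq hz)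
  · intro v hv
    rw [Submodule.mem_orthogonal_singleton_iff_inner_right, inner_gradient_left] at hv
    have hsurj : (fderiv ℝ φ q).range = ⊤ := by
      refine LinearMap.range_eq_top.2 (LinearMap.surjective ?_)
      intro h0
      exact h.fderiv_ne_zero q hq (ContinuousLinearMap.coe_injective h0)
    let w : (fderiv ℝ φ q).ker := ⟨v, hv⟩
    have hline : HasDerivAt (fun t : ℝ => t • w) w 0 := by
      simpa using (hasDerivAt_id (0 : ℝ)).smul_const w
    refine Submodule.subset_span
      ⟨fun t => hs.implicitFunction φ (fderiv ℝ φ q) hsurj (φ q) (t • w), ?_, ?_, ?_⟩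
    · simp
    · have ht0 : Tendsto (fun t : ℝ => t • w) (𝓝 0) (𝓝 0) := by
        simpa using hline.continuousAt.tendsto
      have h1 := hs.tendsto_implicitFunction hsurj (tendsto_const_nhds (x := φ q)) ht0
      have h2 := ((tendsto_const_nhds (x := φ q)).prodMk_nhds ht0).eventually
        (hs.map_implicitFunction_eq hsurj)
      filter_upwards [h1.eventually_mem (h.isOpen.mem_nhds hq), h2] with t htU ht
      rw [h.mem_frontier_iff htU, ← hφq]
      exact ht
    · have h1 := (hs.to_implicitFunction hsurj).hasFDerivAt
      rw [← zero_smul ℝ w] at h1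
      exact h1.comp_hasDerivAt (0 : ℝ) hline

theorem normalSpaceAt_eq (h : IsDefiningFunctionOn K U φ) (hq : q ∈ U) (hqK : q ∈ frontier K) :
    normalSpaceAt (frontier K) q = Submodule.span ℝ {gradient φ q} := by
  rw [normalSpaceAt, h.tangentSpaceAt_eq hq hqK, Submodule.orthogonal_orthogonal]

theorem isOutwardUnitNormal_iff (h : IsDefiningFunctionOn K U φ) (hq : q ∈ U)
    (hqK : q ∈ frontier K) (u : EuclideanSpace ℝ (Fin n)) :
    IsOutwardUnitNormal K q u ↔ u = ‖gradient φ q‖⁻¹ • gradient φ q := by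
  have hs := (h.hasStrictFDerivAt hq).hasFDerivAt
  have hφq := (h.mem_frontier_iff hq).1 hqK
  have hg := h.gradient_ne_zero hq
  have hgn : 0 < ‖gradient φ q‖ := norm_pos_iff.2 hg
  have hgg : fderiv ℝ φ q (gradient φ q) = ‖gradient φ q‖ ^ 2 := by
    rw [← inner_gradient_left, real_inner_self_eq_norm_sq]
  have hline : ∀ u : EuclideanSpace ℝ (Fin n), ∀ᶠ t : ℝ in 𝓝[>] 0, q + t • u ∈ U := by
    intro u
    have hc : ContinuousAt (fun t : ℝ => q + t • u) 0 := by fun_prop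
    exact (hc.eventually_mem (by simpa using h.isOpen.mem_nhds hq)).filter_mono nhdsWithin_le_nhds
  rw [IsOutwardUnitNormal, h.normalSpaceAt_eq hq hqK, Submodule.mem_span_singleton]
  constructor
  · rintro ⟨hu, ⟨c, rfl⟩, hout⟩
    rw [norm_smul, Real.norm_eq_abs] at hu
    -- For `c < 0` the function `φ` would become negative along the ray, so the ray would enter `K`.
    have hc : 0 ≤ c := by
      by_contra! hneg
      have hpos : 0 < (-fderiv ℝ φ q) (c • gradient φ q) := by
        rw [neg_apply, map_smul, hgg, smul_eq_mul]
        nlinarith [pow_pos hgn 2]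
      have hev := eventually_pos_of_fderiv_pos hs.neg (by simp [hφq]) hpos
      obtain ⟨t, h1, h2, h3⟩ := (hev.and (hout.and (hline _))).exists
      refine h2 ((h.mem_iff _ h3).2 ?_)
      exact (neg_pos.1 h1).le
    rw [abs_of_nonneg hc] at hu
    rw [eq_inv_of_mul_eq_one_left hu]
  · rintro rfl
    refine ⟨?_, ⟨_, rfl⟩, ?_⟩
    · rw [norm_smul, norm_inv, norm_norm, inv_mul_cancel₀ hgn.ne']
    · have hpos : 0 < fderiv ℝ φ q (‖gradient φ q‖⁻¹ • gradient φ q) := by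
        rw [map_smul, hgg, smul_eq_mul]
        positivity
      filter_upwards [eventually_pos_of_fderiv_pos hs hφq hpos, hline _] with t ht htU
      rw [h.mem_iff _ htU]
      exact ht.not_ge

theorem outwardNormal_eq (h : IsDefiningFunctionOn K U φ) (hq : q ∈ U) (hqK : q ∈ frontier K) :
    outwardNormal K q = ‖gradient φ q‖⁻¹ • gradient φ q := by
  have hex : ∃ u, IsOutwardUnitNormal K q u := ⟨_, (h.isOutwardUnitNormal_iff hq hqK _).2 rfl⟩
  rw [outwardNormal, dif_pos hex]
  exact (h.isOutwardUnitNormal_iff hq hqK _).1 hex.choose_spec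

theorem norm_outwardNormal (h : IsDefiningFunctionOn K U φ) (hq : q ∈ U) (hqK : q ∈ frontier K) :
    ‖outwardNormal K q‖ = 1 := by
  rw [h.outwardNormal_eq hq hqK]
  exact ((h.isOutwardUnitNormal_iff hq hqK _).2 rfl).1

theorem span_outwardNormal (h : IsDefiningFunctionOn K U φ) (hq : q ∈ U) (hqK : q ∈ frontier K) :
    normalSpaceAt (frontier K) q = Submodule.span ℝ {outwardNormal K q} := by
  rw [h.normalSpaceAt_eq hq hqK, h.outwardNormal_eq hq hqK, Submodule.span_singleton_smul_eq]
  exact (inv_ne_zero (norm_ne_zero_iff.2 (h.gradient_ne_zero hq))).isUnit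

/-- Strict differentiability controls `φ x - φ y` for two moving points. On the boundary this
difference vanishes, so only the linear term remains. -/
theorem exists_abs_inner_le (h : IsDefiningFunctionOn K U φ) (hq : q ∈ U) (hqK : q ∈ frontier K)
    {δ : ℝ} (hδ : 0 < δ) : ∃ r : ℝ, 0 < r ∧ ∀ x ∈ frontier K ∩ Metric.ball q r,
      ∀ y ∈ frontier K ∩ Metric.ball q r,
        |(inner ℝ (outwardNormal K q) (x - y) : ℝ)| ≤ δ * ‖x - y‖ := by
  have hgn : 0 < ‖gradient φ q‖ := norm_pos_iff.2 (h.gradient_ne_zero hq)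
  have hev := (h.hasStrictFDerivAt hq).isLittleO.def (mul_pos hδ hgn)
  obtain ⟨r₁, hr₁, hb⟩ := Metric.eventually_nhds_iff_ball.1 hev
  obtain ⟨r₂, hr₂, hU⟩ := Metric.isOpen_iff.1 h.isOpen q hq
  refine ⟨min r₁ r₂, lt_min hr₁ hr₂, ?_⟩
  rintro x ⟨hxK, hx⟩ y ⟨hyK, hy⟩
  have hxU := hU (Metric.ball_subset_ball (min_le_right _ _) hx)
  have hyU := hU (Metric.ball_subset_ball (min_le_right _ _) hy)
  have hxy : (x, y) ∈ Metric.ball (q, q) r₁ := by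
    rw [← ball_prod_same]
    exact ⟨Metric.ball_subset_ball (min_le_left _ _) hx,
      Metric.ball_subset_ball (min_le_left _ _) hy⟩
  have := hb _ hxy
  simp only [(h.mem_frontier_iff hxU).1 hxK, (h.mem_frontier_iff hyU).1 hyK, sub_self, zero_sub,
    norm_neg, Real.norm_eq_abs] at this
  rw [h.outwardNormal_eq hq hqK, real_inner_smul_left, inner_gradient_left, abs_mul, abs_inv,
    abs_norm, inv_mul_le_iff₀ hgn]
  linarith

/-- The gradient is `C¹` and nonzero, and normalisation is smooth away from `0`; both are locally
Lipschitz. -/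
theorem exists_lipschitzOnWith (h : IsDefiningFunctionOn K U φ) (hq : q ∈ U) :
    ∃ r : ℝ, 0 < r ∧ ∃ L : ℝ, ∀ x ∈ frontier K ∩ Metric.ball q r,
      ∀ y ∈ frontier K ∩ Metric.ball q r,
        ‖outwardNormal K x - outwardNormal K y‖ ≤ L * ‖x - y‖ := by
  have hfd : ContDiffAt ℝ 1 (fderiv ℝ φ) q := (h.contDiffAt hq).fderiv_right (by norm_cast)
  obtain ⟨L₁, s, hs, hL₁⟩ := hfd.exists_lipschitzOnWith
  have hgrad : LipschitzOnWith L₁ (gradient φ) s := by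
    have := (InnerProductSpace.toDual ℝ (EuclideanSpace ℝ (Fin n))).symm.lipschitz
      |>.comp_lipschitzOnWith hL₁
    rwa [one_mul] at this
  have hnorm : ContDiffAt ℝ 1 (fun z : EuclideanSpace ℝ (Fin n) => ‖z‖⁻¹ • z) (gradient φ q) := by
    have hg := h.gradient_ne_zero hq
    exact ((contDiffAt_norm ℝ hg).inv (norm_ne_zero_iff.2 hg)).smul contDiffAt_id
  obtain ⟨L₂, t, ht, hL₂⟩ := hnorm.exists_lipschitzOnWith
  have hcg : ContinuousAt (gradient φ) q := hgrad.continuousOn.continuousAt hs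
  have hmem : s ∩ gradient φ ⁻¹' t ∩ U ∈ 𝓝 q :=
    inter_mem (inter_mem hs (hcg ht)) (h.isOpen.mem_nhds hq)
  obtain ⟨r, hr, hball⟩ := Metric.mem_nhds_iff.1 hmem
  refine ⟨r, hr, (L₂ * L₁ : NNReal), ?_⟩
  rintro x ⟨hxK, hx⟩ y ⟨hyK, hy⟩
  obtain ⟨⟨hxs, hxt⟩, hxU⟩ := hball hx
  obtain ⟨⟨hys, hyt⟩, hyU⟩ := hball hy
  rw [h.outwardNormal_eq hxU hxK, h.outwardNormal_eq hyU hyK, ← dist_eq_norm, ← dist_eq_norm]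
  calc _ ≤ L₂ * dist (gradient φ x) (gradient φ y) := hL₂.dist_le_mul _ hxt _ hyt
    _ ≤ L₂ * (L₁ * dist x y) := by gcongr; exact hgrad.dist_le_mul _ hxs _ hys
    _ = _ := by push_cast; ring

end IsDefiningFunctionOn

namespace HasSmoothBoundary

variable {n : ℕ} {K : Set (EuclideanSpace ℝ (Fin n))}

theorem exists_isDefiningFunctionOn (hK : HasSmoothBoundary K) {p : EuclideanSpace ℝ (Fin n)}
    (hp : p ∈ frontier K) : ∃ U φ, p ∈ U ∧ IsDefiningFunctionOn K U φ := by
  obtain ⟨U, φ, hU, hpU, hφ, hd, hm⟩ := hK p hp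
  exact ⟨U, φ, hpU, hU, hφ, hd, hm⟩

theorem isUnitNormalField (hK : HasSmoothBoundary K) :
    IsUnitNormalField (frontier K) (outwardNormal K) where
  norm_eq_one p hp := by
    obtain ⟨U, φ, hpU, h⟩ := hK.exists_isDefiningFunctionOn hp
    exact h.norm_outwardNormal hpU hp
  abs_inner_le p hp δ hδ := by
    obtain ⟨U, φ, hpU, h⟩ := hK.exists_isDefiningFunctionOn hp
    exact h.exists_abs_inner_le hpU hp hδ
  lipschitz p hp := by
    obtain ⟨U, φ, hpU, h⟩ := hK.exists_isDefiningFunctionOn hp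
    exact h.exists_lipschitzOnWith hpU

theorem tube_eq (hK : HasSmoothBoundary K) (ε : ℝ) :
    tube (frontier K) ε = normalExp (outwardNormal K) '' (frontier K ×ˢ Ioo (-ε) ε) := by
  have hspan : ∀ p ∈ frontier K,
      normalSpaceAt (frontier K) p = Submodule.span ℝ {outwardNormal K p} := by
    intro p hp
    obtain ⟨U, φ, hpU, h⟩ := hK.exists_isDefiningFunctionOn hp
    exact h.span_outwardNormal hpU hp
  have hnorm : ∀ p ∈ frontier K, ∀ t : ℝ, ‖t • outwardNormal K p‖ = |t| := by
    intro p hp t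
    rw [norm_smul, hK.isUnitNormalField.norm_eq_one p hp, mul_one, Real.norm_eq_abs]
  ext x
  constructor
  · rintro ⟨p, hp, a, ha, haε, rfl⟩
    rw [hspan p hp, Submodule.mem_span_singleton] at ha
    obtain ⟨t, rfl⟩ := ha
    rw [hnorm p hp] at haε
    exact ⟨(p, t), ⟨hp, abs_lt.1 haε⟩, rfl⟩
  · rintro ⟨⟨p, t⟩, ⟨hp, ht⟩, rfl⟩
    refine ⟨p, hp, t • outwardNormal K p, ?_, ?_, rfl⟩
    · rw [hspan p hp]
      exact Submodule.smul_mem _ _ (Submodule.mem_span_singleton_self _)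
    · rw [hnorm p hp]
      exact abs_lt.2 ht

end HasSmoothBoundary

/-! ### The integral of `|ν · u|` over the sphere, from a Gaussian integral. -/

theorem integral_Ioi_pow_mul_exp_neg_sq (m : ℕ) :
    ∫ r in Ioi (0 : ℝ), r ^ m * (r * Real.exp (-r ^ 2)) = Real.Gamma ((m : ℝ) / 2 + 1) / 2 := by
  have h := integral_rpow_mul_exp_neg_rpow (p := 2) (q := (m + 1 : ℕ)) two_pos
    (by linarith [Nat.cast_nonneg (α := ℝ) (m + 1)])
  simp only [Real.rpow_natCast, Real.rpow_two] at h
  rw [show (m : ℝ) / 2 + 1 = (((m + 1 : ℕ) : ℝ) + 1) / 2 by push_cast; ring, div_eq_inv_mul,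
    ← one_div, ← h]
  refine integral_congr_ae (ae_of_all _ fun r => ?_)
  simp only
  ring

theorem integral_abs_mul_exp_neg_sq : ∫ t : ℝ, |t| * Real.exp (-t ^ 2) = 1 := by
  have h := integral_comp_abs (f := fun t : ℝ => t * Real.exp (-t ^ 2))
  simp only [sq_abs] at h
  have h0 := integral_Ioi_pow_mul_exp_neg_sq 0
  simp only [pow_zero, one_mul, Nat.cast_zero, zero_div, zero_add, Real.Gamma_one] at h0
  rw [h, h0]
  norm_num

/-- Rotate `u` to the first basis vector. The integrand becomes a product over coordinates: the
first factor integrates to 1, the other `m` to `√π`. -/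
theorem integral_abs_inner_mul_exp_neg_norm_sq {m : ℕ} {u : EuclideanSpace ℝ (Fin (m + 1))}
    (hu : ‖u‖ = 1) :
    ∫ x : EuclideanSpace ℝ (Fin (m + 1)), |(inner ℝ x u : ℝ)| * Real.exp (-‖x‖ ^ 2) =
      √Real.pi ^ m := by
  have hon : Orthonormal ℝ (({0} : Set (Fin (m + 1))).domRestrict fun _ => u) :=
    ⟨fun _ => hu, fun i j hij => absurd (Subsingleton.elim i j) hij⟩
  obtain ⟨b, hb⟩ := hon.exists_orthonormalBasis_extension_of_card_eq (by simp)
  have hb0 : b 0 = u := hb 0 rfl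
  have h1 : ∀ x : EuclideanSpace ℝ (Fin (m + 1)), |(inner ℝ x u : ℝ)| * Real.exp (-‖x‖ ^ 2) =
      (fun y : EuclideanSpace ℝ (Fin (m + 1)) => |y 0| * Real.exp (-‖y‖ ^ 2)) (b.repr x) := by
    intro x
    simp only [LinearIsometryEquiv.norm_map, b.repr_apply_apply, hb0, real_inner_comm]
  have hrot := b.measurePreserving_repr.integral_comp b.repr.toHomeomorph.measurableEmbedding
    fun y : EuclideanSpace ℝ (Fin (m + 1)) => |y 0| * Real.exp (-‖y‖ ^ 2)
  rw [integral_congr_ae (ae_of_all _ h1), hrot,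
    ← (EuclideanSpace.volume_preserving_symm_measurableEquiv_toLp (Fin (m + 1))).symm.integral_comp']
  let f : Fin (m + 1) → ℝ → ℝ :=
    Fin.cons (fun t => |t| * Real.exp (-t ^ 2)) fun _ t => Real.exp (-t ^ 2)
  have h2 : ∀ y : Fin (m + 1) → ℝ, |y 0| * Real.exp (-‖(WithLp.toLp 2 y :
      EuclideanSpace ℝ (Fin (m + 1)))‖ ^ 2) = ∏ i, f i (y i) := by
    intro y
    rw [EuclideanSpace.norm_sq_eq, ← Finset.sum_neg_distrib, Real.exp_sum, Fin.prod_univ_succ,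
      Fin.prod_univ_succ]
    simp [f, mul_assoc]
  have h3 := integral_fintype_prod_volume_eq_prod (ι := Fin (m + 1)) f
  simp_rw [← h2] at h3
  refine Eq.trans ?_ (h3.trans ?_)
  · rfl
  · have hg := integral_gaussian 1
    simp only [neg_mul, one_mul, div_one] at hg
    rw [Fin.prod_univ_succ]
    simp [f, integral_abs_mul_exp_neg_sq, hg]

/-- Polar coordinates: `|x · u|` is homogeneous of degree 1, which puts an extra `r` beside the
density `r ^ m`. -/
theorem integral_abs_inner_mul_exp_neg_norm_sq_eq_sphere {m : ℕ}
    (u : EuclideanSpace ℝ (Fin (m + 1))) :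
    ∫ x : EuclideanSpace ℝ (Fin (m + 1)), |(inner ℝ x u : ℝ)| * Real.exp (-‖x‖ ^ 2) =
      (∫ ν : Metric.sphere (0 : EuclideanSpace ℝ (Fin (m + 1))) 1, |(inner ℝ (ν : EuclideanSpace ℝ
        (Fin (m + 1))) u : ℝ)| ∂(volume : Measure (EuclideanSpace ℝ (Fin (m + 1)))).toSphere) *
      (Real.Gamma ((m : ℝ) / 2 + 1) / 2) := by
  set μ : Measure (EuclideanSpace ℝ (Fin (m + 1))) := volume with hμ
  have hdim : Module.finrank ℝ (EuclideanSpace ℝ (Fin (m + 1))) - 1 = m := by simp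
  calc ∫ x, |(inner ℝ x u : ℝ)| * Real.exp (-‖x‖ ^ 2) ∂μ
      = ∫ x : ({(0)}ᶜ : Set (EuclideanSpace ℝ (Fin (m + 1)))),
          |(inner ℝ x.1 u : ℝ)| * Real.exp (-‖x.1‖ ^ 2) ∂(μ.comap (↑)) := by
        rw [integral_subtype_comap (measurableSet_singleton _).compl
          fun x => |(inner ℝ x u : ℝ)| * Real.exp (-‖x‖ ^ 2), restrict_compl_singleton]
    _ = ∫ p : Metric.sphere (0 : EuclideanSpace ℝ (Fin (m + 1))) 1 × Ioi (0 : ℝ),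
          |(inner ℝ p.1.1 u : ℝ)| * (p.2.1 * Real.exp (-p.2.1 ^ 2))
            ∂μ.toSphere.prod (.volumeIoiPow m) := by
        have hpres := μ.measurePreserving_homeomorphUnitSphereProd
        rw [hdim] at hpres
        rw [← hpres.integral_comp (Homeomorph.measurableEmbedding _)]
        refine integral_congr_ae (ae_of_all _ fun x => ?_)
        have hx : (0 : ℝ) < ‖x.1‖ := norm_pos_iff.2 x.2
        simp only [homeomorphUnitSphereProd_apply_fst_coe, homeomorphUnitSphereProd_apply_snd_coe,
          real_inner_smul_left, abs_mul, abs_inv, abs_norm]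
        field_simp
    _ = (∫ ν : Metric.sphere (0 : EuclideanSpace ℝ (Fin (m + 1))) 1,
          |(inner ℝ ν.1 u : ℝ)| ∂μ.toSphere) *
        ∫ r : Ioi (0 : ℝ), r.1 * Real.exp (-r.1 ^ 2) ∂.volumeIoiPow m :=
      integral_prod_mul (fun ν : Metric.sphere (0 : EuclideanSpace ℝ (Fin (m + 1))) 1 =>
        |(inner ℝ ν.1 u : ℝ)|) fun r : Ioi (0 : ℝ) => r.1 * Real.exp (-r.1 ^ 2)
    _ = _ := by
      congr 1
      rw [← integral_Ioi_pow_mul_exp_neg_sq]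
      simp only [Measure.volumeIoiPow, ENNReal.ofReal]
      rw [integral_withDensity_eq_integral_smul,
        integral_subtype_comap measurableSet_Ioi fun a : ℝ =>
          Real.toNNReal (a ^ m) • (a * Real.exp (-a ^ 2)),
        setIntegral_congr_fun measurableSet_Ioi fun x hx => ?_]
      · simp only [NNReal.smul_def, smul_eq_mul]
        rw [Real.coe_toNNReal _ (pow_nonneg (le_of_lt hx) _)]
      · exact (measurable_subtype_coe.pow_const _).real_toNNReal

theorem unitBallVolume_eq (m : ℕ) :
    unitBallVolume m = ENNReal.ofReal (√Real.pi ^ m / Real.Gamma ((m : ℝ) / 2 + 1)) := by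
  rcases m with _ | m
  · have : Metric.ball (0 : EuclideanSpace ℝ (Fin 0)) 1 = {0} := by
      ext x
      simp [Subsingleton.elim x 0]
    rw [unitBallVolume, this, ← EuclideanSpace.euclideanHausdorffMeasure_eq_volume,
      Measure.euclideanHausdorffMeasure_zero, Measure.hausdorffMeasure_zero_singleton]
    simp
  · rw [unitBallVolume, EuclideanSpace.volume_ball]
    simp

theorem lintegral_sphere_abs_inner {m : ℕ} {u : EuclideanSpace ℝ (Fin (m + 1))} (hu : ‖u‖ = 1) :
    ∫⁻ ν : Metric.sphere (0 : EuclideanSpace ℝ (Fin (m + 1))) 1,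
      ENNReal.ofReal |(inner ℝ (ν : EuclideanSpace ℝ (Fin (m + 1))) u : ℝ)|
        ∂(volume : Measure (EuclideanSpace ℝ (Fin (m + 1)))).toSphere = 2 * unitBallVolume m := by
  have hint : Integrable (fun ν : Metric.sphere (0 : EuclideanSpace ℝ (Fin (m + 1))) 1 =>
      |(inner ℝ (ν : EuclideanSpace ℝ (Fin (m + 1))) u : ℝ)|)
      (volume : Measure (EuclideanSpace ℝ (Fin (m + 1)))).toSphere := by
    refine Integrable.of_bound (C := 1) (by fun_prop) (ae_of_all _ fun ν => ?_)
    rw [Real.norm_eq_abs, abs_abs]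
    refine (abs_real_inner_le_norm _ _).trans ?_
    rw [hu, norm_eq_of_mem_sphere, one_mul]
  rw [← ofReal_integral_eq_lintegral_ofReal hint (ae_of_all _ fun ν => abs_nonneg _),
    unitBallVolume_eq, show (2 : ℝ≥0∞) * _ = ENNReal.ofReal 2 * _ by rw [ENNReal.ofReal_ofNat],
    ← ENNReal.ofReal_mul two_pos.le]
  congr 1
  -- Equating the two evaluations of the Gaussian integral gives the sphere integral as `2 √π ^ m /
  -- Γ(m / 2 + 1)`.
  have h := (integral_abs_inner_mul_exp_neg_norm_sq_eq_sphere u).symm.trans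
    (integral_abs_inner_mul_exp_neg_norm_sq hu)
  have hΓ : 0 < Real.Gamma ((m : ℝ) / 2 + 1) := Real.Gamma_pos_of_pos (by positivity)
  rw [mul_div_assoc', eq_div_iff hΓ.ne']
  linarith

/-! ### Cauchy's formula and the conclusion. -/

theorem surfaceArea_eq_measure {n : ℕ} (K : Set (EuclideanSpace ℝ (Fin n))) :
    surfaceArea K = Measure.euclideanHausdorffMeasure (n - 1) (frontier K) := by
  rw [surfaceArea, lintegral_one, boundaryMeasure, Measure.restrict_apply_univ]

/-- Cauchy's surface area formula. -/
theorem HasSmoothBoundary.cauchyArea_eq {n : ℕ} (hn : 1 ≤ n) {K : Set (EuclideanSpace ℝ (Fin n))}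
    (hc : IsCompact (frontier K)) (hK : HasSmoothBoundary K) : cauchyArea K = surfaceArea K := by
  obtain ⟨m, rfl⟩ : ∃ m, n = m + 1 := ⟨n - 1, by omega⟩
  have hN := hK.isUnitNormalField
  -- The tube estimates supply the finiteness that exchanging the integrals requires.
  have hfin : IsFiniteMeasure (boundaryMeasure K) :=
    ⟨by
      rw [boundaryMeasure, Measure.restrict_apply_univ]
      exact hN.measure_lt_top hn hc⟩
  have hmeas : AEMeasurable (outwardNormal K) (boundaryMeasure K) :=
    hN.continuousOn.aemeasurable hc.measurableSet
  have hω0 : unitBallVolume m ≠ 0 :=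
    (Metric.isOpen_ball.measure_pos _ (Metric.nonempty_ball.2 one_pos)).ne'
  have hωtop : unitBallVolume m ≠ ⊤ := measure_ball_lt_top.ne
  have hswap : ∫⁻ ν : Metric.sphere (0 : EuclideanSpace ℝ (Fin (m + 1))) 1,
      ∫⁻ q, ENNReal.ofReal |(inner ℝ (ν : EuclideanSpace ℝ (Fin (m + 1))) (outwardNormal K q) : ℝ)|
        ∂boundaryMeasure K ∂(volume : Measure (EuclideanSpace ℝ (Fin (m + 1)))).toSphere =
      2 * unitBallVolume m * surfaceArea K := by
    rw [lintegral_lintegral_swap]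
    · rw [surfaceArea, ← lintegral_const_mul _ measurable_const]
      refine lintegral_congr_ae ?_
      filter_upwards [ae_restrict_mem hc.measurableSet] with q hq
      rw [lintegral_sphere_abs_inner (hN.norm_eq_one q hq), mul_one]
    · have h1 : AEMeasurable (fun z : Metric.sphere (0 : EuclideanSpace ℝ (Fin (m + 1))) 1 ×
          EuclideanSpace ℝ (Fin (m + 1)) => outwardNormal K z.2)
          ((volume : Measure (EuclideanSpace ℝ (Fin (m + 1)))).toSphere.prod (boundaryMeasure K)) :=
        hmeas.comp_snd
      have h2 : AEMeasurable (fun z : Metric.sphere (0 : EuclideanSpace ℝ (Fin (m + 1))) 1 ×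
          EuclideanSpace ℝ (Fin (m + 1)) => (z.1 : EuclideanSpace ℝ (Fin (m + 1))))
          ((volume : Measure (EuclideanSpace ℝ (Fin (m + 1)))).toSphere.prod (boundaryMeasure K)) :=
        (measurable_subtype_coe.comp measurable_fst).aemeasurable
      exact (continuous_abs.measurable.comp_aemeasurable (h2.inner h1)).ennreal_ofReal
  rw [cauchyArea, Nat.add_sub_cancel]
  simp only [weightedProjectedArea]
  rw [lintegral_const_mul' _ _ (by simp), hswap, one_div, one_div]
  calc _ = (unitBallVolume m)⁻¹ * unitBallVolume m * ((2 : ℝ≥0∞)⁻¹ * 2) * surfaceArea K := by ring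
    _ = surfaceArea K := by
      rw [ENNReal.inv_mul_cancel hω0 hωtop, ENNReal.inv_mul_cancel (by norm_num) (by norm_num),
        one_mul, one_mul]

end CauchySurface

theorem proposition3 (n : ℕ) (hn : 1 ≤ n) (K : Set (EuclideanSpace ℝ (Fin n)))
    (hK : IsCompact K) (hsmooth : CauchySurface.HasSmoothBoundary K) :
    CauchySurface.cauchyArea K ≠ ⊤ ∧
    CauchySurface.surfaceArea K = CauchySurface.cauchyArea K ∧
    Tendsto (fun ε : ℝ => volume (CauchySurface.tube (frontier K) ε) / ENNReal.ofReal (2 * ε))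
      (𝓝[>] 0) (𝓝 (CauchySurface.cauchyArea K)) := by
  have hc : IsCompact (frontier K) :=
    hK.of_isClosed_subset isClosed_frontier (frontier_subset_closure.trans
      hK.isClosed.closure_subset)
  have hN := hsmooth.isUnitNormalField
  rw [hsmooth.cauchyArea_eq hn hc, CauchySurface.surfaceArea_eq_measure]
  refine ⟨(hN.measure_lt_top hn hc).ne, rfl, ?_⟩
  simp_rw [hsmooth.tube_eq]
  exact hN.tendsto_volume_div hn hc
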